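/- Graphs are finite and non-empty. Let $G$ be a simple bridgeless cubic graph. A 1-factor of $G$ is a spanning 1-regular subgraph, identified with its edge set. Let $\mu_3(G) = |E(G)| - \max |M_1 \cup M_2 \cup M_3|$, where the maximum is over all triples of 1-factors of $G$, not necessarily distinct. If $M_1, M_2, M_3$ are three pairwise different 1-factors of $G$ and exactly $k$ edges of $G$ lie in none of them, then the $k$-core of $G$ with respect to $M_1, M_2, M_3$ is the subgraph of $G$ whose edges are the edges lying in none or in at least two of $M_1, M_2, M_3$, and whose vertices are the endvertices of these edges. A core is a $k$-core for some $k \ge 0$, and a core is cyclic if it is 2-regular, i.e. a (possibly empty) disjoint union of circuits. (a) If $\mu_3(G) \leq 6$, then $G$ has a cyclic core; more precisely, $G$ has pairwise different 1-factors $M_1, M_2, M_3$ such that $M_1 \cap M_2 \cap M_3 = \emptyset$ and the core with respect to $M_1, M_2, M_3$ is cyclic. In particular, the Fan--Raspaud conjecture (every bridgeless cubic graph has three 1-factors with empty common intersection) holds for $G$. (b) If $G$ is triangle-free and $\mu_3(G) \leq 5$, then every $\mu_3(G)$-core of $G$ is cyclic. -/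

import Mathlib

namespace CubicCover

variable {V : Type*} (G : SimpleGraph V)

/-- No edge of `G` is a bridge. -/
def Bridgeless : Prop := ∀ e ∈ G.edgeSet, ¬ G.IsBridge e

/-- `M` lists `k` 1-factors (spanning 1-regular subgraphs) of `G`, repetitions allowed. -/
def AreOneFactors {k : ℕ} (M : Fin k → G.Subgraph) : Prop :=
  ∀ i, (M i).IsPerfectMatching

/-- `m_k(G)`: the maximum number of edges in a union of `k` 1-factors of `G`. -/
noncomputable def maxCover (k : ℕ) : ℕ :=
  sSup {n : ℕ | ∃ M : Fin k → G.Subgraph,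
    AreOneFactors G M ∧ n = (⋃ i, (M i).edgeSet).ncard}

/-- `μ_k(G) = |E(G)| - m_k(G)`. -/
noncomputable def mu (k : ℕ) : ℕ := G.edgeSet.ncard - maxCover G k

/-- The subgraph `G[X]`: its edges are the edges of `G` in `X`, its vertices their ends. -/
def edgeInduced (X : Set (Sym2 V)) : G.Subgraph where
  verts := {v | ∃ w, G.Adj v w ∧ s(v, w) ∈ X}
  Adj v w := G.Adj v w ∧ s(v, w) ∈ X
  adj_sub h := h.1
  edge_vert h := ⟨_, h⟩
  symm := ⟨fun _ _ h => ⟨h.1.symm, Sym2.eq_swap ▸ h.2⟩⟩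

/-- The edges that lie in more than one of the three subgraphs. -/
def multiplyCovered (M : Fin 3 → G.Subgraph) : Set (Sym2 V) :=
  {e | ∃ i j, i ≠ j ∧ e ∈ (M i).edgeSet ∧ e ∈ (M j).edgeSet}

/-- The edges of `G` that lie in none of the three subgraphs. -/
def uncovered (M : Fin 3 → G.Subgraph) : Set (Sym2 V) :=
  G.edgeSet \ ⋃ i, (M i).edgeSet

/-- `H` is the `k`-core of `G` with respect to the 1-factors `M 0`, `M 1`, `M 2`,
which have to be pairwise different. -/
def IsCoreOf (k : ℕ) (M : Fin 3 → G.Subgraph) (H : G.Subgraph) : Prop :=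
  AreOneFactors G M ∧ Function.Injective M ∧ (uncovered G M).ncard = k ∧
    H = edgeInduced G (multiplyCovered G M ∪ uncovered G M)

/-- `H` is a `k`-core of `G`. -/
def IsCore (k : ℕ) (H : G.Subgraph) : Prop := ∃ M : Fin 3 → G.Subgraph, IsCoreOf G k M H

variable {G} in
/-- `H` is a cycle, i.e. 2-regular: a (possibly empty) disjoint union of circuits. -/
def IsCycle (H : G.Subgraph) : Prop := ∀ v ∈ H.verts, (H.neighborSet v).ncard = 2

end CubicCover

/-! Fix a triple of 1-factors attaining $\mu_3$. Let U be the set of uncovered edges, D the edges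
covered at least twice, T those in all three. Three 1-factors have $|E(G)|$ edges in total, so
inclusion-exclusion gives $|U| = |D| + |T|$ and $|D| + 2|T| = \sum |M_i \cap M_j|$
(`ncard_inter_sum`). If T is empty, the core is cyclic (`isCycle_edgeInduced`), so both parts aim at
an empty common intersection.

For (a), suppose two of the 1-factors share at most two edges. By Tutte's theorem some 1-factor
avoids these (`exists_isPerfectMatching_avoiding`) and completes the pair to a triple with empty
intersection. Otherwise the pairwise intersections sum to at least 9, and $|U| \le 6$ forces D = T ≠
∅. Then the three 1-factors agree on the component of an edge of T, and changing one of them there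
covers more, against optimality.

For (b), let xy be in T. The four other edges at x and y are uncovered, and each of their outer ends
meets an edge of D. Triangle-freeness and an exchange along a 4-circuit make these four edges
distinct, and none is xy. So $|D| \ge 5$ and $|U| \ge 6$. -/

namespace CubicCover

open Finset

/-! ### 1-factors avoiding two prescribed edges, by Tutte's theorem -/

section Avoid

variable {V : Type*} [Fintype V] [DecidableEq V] {G : SimpleGraph V} [DecidableRel G.Adj]

/-- The pairs of adjacent vertices `(v, w)` with `v ∈ C` and `w ∉ C`. -/
def boundary (G : SimpleGraph V) [DecidableRel G.Adj] (C : Finset V) : Finset (V × V) :=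
  (C ×ˢ Cᶜ).filter fun d => G.Adj d.1 d.2

lemma mem_boundary {C : Finset V} {d : V × V} :
    d ∈ boundary G C ↔ d.1 ∈ C ∧ d.2 ∉ C ∧ G.Adj d.1 d.2 := by
  simp [boundary, and_assoc]

omit [Fintype V] [DecidableEq V] in
-- Swapping the two coordinates is an involution without fixed points on these ordered pairs.
lemma even_card_adj_product (C : Finset V) :
    Even ((C ×ˢ C).filter fun d => G.Adj d.1 d.2).card := by
  rw [← ZMod.natCast_eq_zero_iff_even, Finset.cast_card]
  refine Finset.sum_involution (fun d _ => d.swap) ?_ ?_ ?_ ?_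
  · intros; decide
  · rintro ⟨a, b⟩ h _ h'
    simp only [mem_filter, mem_product] at h
    exact h.2.ne (congrArg Prod.snd h')
  · rintro ⟨a, b⟩ h
    simp only [mem_filter, mem_product, Prod.swap] at h ⊢
    exact ⟨h.1.symm, h.2.symm⟩
  · intros; rfl

omit [DecidableEq V] in
lemma card_product_adj (hcubic : G.IsRegularOfDegree 3) (C : Finset V) :
    ((C ×ˢ univ).filter fun d => G.Adj d.1 d.2).card = 3 * C.card := by
  rw [Finset.card_filter, Finset.sum_product]
  simp_rw [← Finset.card_filter]
  rw [Finset.sum_const_nat (m := 3), mul_comm]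
  intro v _
  rw [← hcubic v, ← G.card_neighborFinset_eq_degree]
  congr 1
  ext w
  simp

lemma odd_card_boundary (hcubic : G.IsRegularOfDegree 3) {C : Finset V} (hC : Odd C.card) :
    Odd (boundary G C).card := by
  have h1 := card_product_adj hcubic C
  have h2 := even_card_adj_product (G := G) C
  have h3 : ((C ×ˢ univ).filter fun d => G.Adj d.1 d.2) =
      ((C ×ˢ C).filter fun d => G.Adj d.1 d.2) ∪ boundary G C := by
    ext d
    simp only [mem_filter, mem_product, mem_union, mem_boundary, mem_univ]
    tauto
  have h4 : Disjoint ((C ×ˢ C).filter fun d => G.Adj d.1 d.2) (boundary G C) := by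
    rw [Finset.disjoint_left]
    intro d hd hd'
    simp only [mem_filter, mem_product, mem_boundary] at hd hd'
    tauto
  rw [h3, card_union_of_disjoint h4] at h1
  obtain ⟨a, ha⟩ := h2
  obtain ⟨b, hb⟩ := hC
  rw [Nat.odd_iff]
  omega

/-- The boundary has odd size, and a single boundary edge would be a bridge: any walk joining its
ends crosses the boundary. -/
lemma three_le_card_boundary (hcubic : G.IsRegularOfDegree 3) (hbridge : Bridgeless G)
    {C : Finset V} (hC : Odd C.card) : 3 ≤ (boundary G C).card := by
  have hodd := odd_card_boundary hcubic hC
  by_contra! hlt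
  have h1 : (boundary G C).card = 1 := by
    obtain ⟨b, hb⟩ := hodd
    omega
  obtain ⟨⟨v, w⟩, hvw⟩ := card_eq_one.1 h1
  have hmem : (v, w) ∈ boundary G C := by simp [hvw]
  rw [mem_boundary] at hmem
  refine hbridge s(v, w) hmem.2.2 ?_
  rw [SimpleGraph.isBridge_iff]
  rintro ⟨p⟩
  obtain ⟨d, -, hd1, hd2⟩ := p.exists_boundary_dart (C : Set V) hmem.1 hmem.2.1
  have hd := d.adj
  rw [SimpleGraph.deleteEdges_adj] at hd
  have : (d.fst, d.snd) ∈ boundary G C := mem_boundary.2 ⟨hd1, hd2, hd.1⟩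
  rw [hvw, mem_singleton, Prod.ext_iff] at this
  obtain ⟨h, h'⟩ := this
  simp only at h h'
  exact hd.2 (by simp [h, h'])

omit [DecidableEq V] in
lemma even_card_of_cubic (hcubic : G.IsRegularOfDegree 3) : Even (Fintype.card V) := by
  have h := G.sum_degrees_eq_twice_card_edges
  rw [Finset.sum_const_nat (m := 3) fun v _ => hcubic v, card_univ] at h
  rw [Nat.even_iff]
  omega

lemma card_mk_mem_le (F : Finset (Sym2 V)) :
    ((univ : Finset (V × V)).filter fun d => s(d.1, d.2) ∈ F).card ≤ 2 * F.card := by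
  refine Finset.card_le_mul_card_image_of_maps_to (f := fun d : V × V => s(d.1, d.2))
    (fun d hd => by simpa using hd) 2 ?_
  intro e _
  induction e with | h a b =>
  refine (card_le_card (t := {(a, b), (b, a)}) ?_).trans card_le_two
  rintro ⟨c, d⟩ h
  simpa using (mem_filter.1 h).2

/-- In a bridgeless cubic graph, some 1-factor avoids any two given edges. -/
theorem exists_isPerfectMatching_avoiding (hcubic : G.IsRegularOfDegree 3)
    (hbridge : Bridgeless G) (F : Finset (Sym2 V)) (hF : F.card ≤ 2) :
    ∃ M : G.Subgraph, M.IsPerfectMatching ∧ ∀ e ∈ F, e ∉ M.edgeSet := by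
  classical
  suffices h : ∃ M : (G.deleteEdges F).Subgraph, M.IsPerfectMatching by
    obtain ⟨M, hM⟩ := h
    refine ⟨M.map (SimpleGraph.Hom.ofLE (G.deleteEdges_le F)), ⟨hM.1.map_ofLE _, ?_⟩, ?_⟩
    · intro v
      exact ⟨v, hM.2 v, rfl⟩
    · intro e he h
      induction e with | h a b =>
      rw [SimpleGraph.Subgraph.mem_edgeSet] at h
      obtain ⟨a', b', hab, rfl, rfl⟩ := h
      have := hab.adj_sub
      rw [SimpleGraph.deleteEdges_adj] at this
      exact this.2 he
  rw [SimpleGraph.tutte]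
  intro u hu
  set K := ((⊤ : (G.deleteEdges F).Subgraph).deleteVerts u).coe with hK
  have hu' : u.ncard < K.oddComponents.ncard := hu
  have hparity : Odd K.oddComponents.ncard ↔ Odd (Nat.card _) :=
    SimpleGraph.odd_ncard_oddComponents K
  have hcard : Nat.card ((⊤ : (G.deleteEdges F).Subgraph).deleteVerts u).verts + u.ncard =
      Fintype.card V := by
    rw [← Nat.card_eq_fintype_card, ← Set.ncard_add_ncard_compl u, add_comm]
    congr 1
    rw [Nat.card_coe_set_eq]
    congr 1
    ext v
    simp
  have hV := even_card_of_cubic hcubic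
  -- As $|V|$ is even, the number of odd components has the parity of $|u|$, so an excess of one is
  -- impossible.
  have hge : u.ncard + 2 ≤ K.oddComponents.ncard := by
    rw [Nat.odd_iff, Nat.odd_iff] at hparity
    rw [Nat.even_iff] at hV
    omega
  let comp : K.ConnectedComponent → Finset V := fun c =>
    c.supp.toFinset.map ⟨_, Subtype.val_injective⟩
  have hmem_comp : ∀ c v, v ∈ comp c ↔ ∃ h, K.connectedComponentMk ⟨v, h⟩ = c := by
    intro c v
    simp [comp]
  have hodd : ∀ c ∈ K.oddComponents, Odd (comp c).card := by
    intro c hc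
    have hc' : Odd c.supp.ncard := hc
    rwa [card_map, ← Set.ncard_eq_toFinset_card']
  have hdisj : ((K.oddComponents.toFinset : Finset _) : Set K.ConnectedComponent).PairwiseDisjoint
      (fun c => boundary G (comp c)) := by
    intro c _ c' _ hne
    rw [Function.onFun, Finset.disjoint_left]
    intro d hd hd'
    rw [mem_boundary, hmem_comp] at hd hd'
    obtain ⟨⟨_, h⟩, -⟩ := hd
    obtain ⟨⟨_, h'⟩, -⟩ := hd'
    exact hne (h.symm.trans h')
  -- An edge of `G` leaving a component of `K` either ends in `u` or is one of the deleted edges.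
  let D := (((u.toFinset ×ˢ univ).filter fun d => G.Adj d.1 d.2).map
    ⟨Prod.swap, Prod.swap_injective⟩) ∪ (univ.filter fun d : V × V => s(d.1, d.2) ∈ F)
  have hsub : K.oddComponents.toFinset.biUnion (fun c => boundary G (comp c)) ⊆ D := by
    intro d hd
    rw [mem_biUnion] at hd
    obtain ⟨c, -, hd⟩ := hd
    rw [mem_boundary, hmem_comp, hmem_comp] at hd
    obtain ⟨⟨h1, h2⟩, h3, h4⟩ := hd
    by_cases hF' : s(d.1, d.2) ∈ F
    · exact mem_union_right _ (by simpa using hF')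
    by_cases hdu : d.2 ∈ u
    · refine mem_union_left _ ?_
      rw [mem_map]
      exact ⟨d.swap, by simpa [hdu] using h4.symm, by simp⟩
    · refine absurd ⟨by simpa using hdu, ?_⟩ h3
      rw [← h2, SimpleGraph.ConnectedComponent.eq]
      refine SimpleGraph.Adj.reachable ?_
      have h1' : d.1 ∉ u := by simpa using h1
      simp [hK, h1', hdu, h4.symm, Sym2.eq_swap, hF']
  have hcount := card_le_card hsub
  rw [card_biUnion hdisj] at hcount
  have hlow : K.oddComponents.toFinset.card * 3 ≤
      ∑ c ∈ K.oddComponents.toFinset, (boundary G (comp c)).card := by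
    rw [← smul_eq_mul]
    exact Finset.card_nsmul_le_sum _ _ _ fun c hc =>
      three_le_card_boundary hcubic hbridge (hodd c (by simpa using hc))
  -- A deleted edge may count from both ends. With $|F| \le 2$ the bound is $3|u| + 4$, less than
  -- the $3(|u| + 2)$ pairs leaving odd components.
  have hD : D.card ≤ 3 * u.ncard + 2 * F.card := by
    refine (card_union_le _ _).trans (add_le_add ?_ (card_mk_mem_le F))
    rw [card_map, card_product_adj hcubic, ← Set.ncard_eq_toFinset_card']
  rw [← Set.ncard_eq_toFinset_card'] at hlow
  omega

end Avoid

end CubicCover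

namespace CubicCover

/-! ### 1-factors as fixed-point-free involutions -/

section Partner

variable {V : Type*} {G : SimpleGraph V}

/-- The 1-factor whose edges join each vertex `v` to `f v`. -/
def ofPartner (f : V → V) (hadj : ∀ v, G.Adj v (f v)) (hinv : ∀ v, f (f v) = v) :
    G.Subgraph where
  verts := Set.univ
  Adj v w := f v = w
  adj_sub h := h ▸ hadj _
  edge_vert _ := Set.mem_univ _
  symm := ⟨fun v _ h => h ▸ hinv v⟩

lemma ofPartner_isPerfectMatching {f : V → V} (hadj : ∀ v, G.Adj v (f v))
    (hinv : ∀ v, f (f v) = v) : (ofPartner f hadj hinv).IsPerfectMatching :=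
  SimpleGraph.Subgraph.isPerfectMatching_iff.2 fun v => ⟨f v, rfl, fun _ h => Eq.symm h⟩

lemma exists_partner {M : G.Subgraph} (hM : M.IsPerfectMatching) :
    ∃ f : V → V, (∀ v, G.Adj v (f v)) ∧ (∀ v, f (f v) = v) ∧ ∀ v w, M.Adj v w ↔ f v = w := by
  rw [SimpleGraph.Subgraph.isPerfectMatching_iff] at hM
  choose f hf hf' using hM
  have h : ∀ v w, M.Adj v w ↔ f v = w :=
    fun v w => ⟨fun h => (hf' v w h).symm, fun h => h ▸ hf v⟩
  exact ⟨f, fun v => (hf v).adj_sub, fun v => (h _ _).1 (hf v).symm, h⟩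

lemma AreOneFactors.exists_partners {k : ℕ} {M : Fin k → G.Subgraph} (hM : AreOneFactors G M) :
    ∃ f : Fin k → V → V, (∀ i v, G.Adj v (f i v)) ∧ (∀ i v, f i (f i v) = v) ∧
      ∀ i v w, (M i).Adj v w ↔ f i v = w := by
  choose f h1 h2 h3 using fun i => exists_partner (hM i)
  exact ⟨f, h1, h2, h3⟩

lemma mk_mem_multiplyCovered {M : Fin 3 → G.Subgraph} {v w : V} :
    s(v, w) ∈ multiplyCovered G M ↔ ∃ i j, i ≠ j ∧ (M i).Adj v w ∧ (M j).Adj v w :=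
  Iff.rfl

lemma mk_mem_uncovered {M : Fin 3 → G.Subgraph} {v w : V} :
    s(v, w) ∈ uncovered G M ↔ G.Adj v w ∧ ∀ i, ¬ (M i).Adj v w := by
  simp [uncovered]

end Partner

/-! ### Edge counts of cubic graphs and 1-factors -/

section Count

variable {V : Type*} [Fintype V] {G : SimpleGraph V} [DecidableRel G.Adj]

lemma two_mul_ncard_edgeSet (hcubic : G.IsRegularOfDegree 3) :
    2 * G.edgeSet.ncard = 3 * Fintype.card V := by
  have h := G.sum_degrees_eq_twice_card_edges
  rw [Finset.sum_const_nat (m := 3) fun v _ => hcubic v, Finset.card_univ] at h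
  rw [← SimpleGraph.coe_edgeFinset, Set.ncard_coe_finset]
  omega

omit [DecidableRel G.Adj] in
lemma two_mul_ncard_edgeSet_of_isPerfectMatching {M : G.Subgraph} (hM : M.IsPerfectMatching) :
    2 * M.edgeSet.ncard = Fintype.card V := by
  classical
  have h := M.spanningCoe.sum_degrees_eq_twice_card_edges
  rw [Finset.sum_const_nat (m := 1), Finset.card_univ, mul_one] at h
  · rw [← SimpleGraph.Subgraph.edgeSet_spanningCoe, ← SimpleGraph.coe_edgeFinset,
      Set.ncard_coe_finset]
    omega
  · intro v _
    rw [SimpleGraph.degree_eq_one_iff_existsUnique_adj]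
    exact SimpleGraph.Subgraph.isPerfectMatching_iff.1 hM v

end Count

end CubicCover

namespace CubicCover

/-! ### Optimal triples and exchange -/

section Cover

variable {V : Type*} [Fintype V] {G : SimpleGraph V}

omit [Fintype V] in
lemma iUnion_edgeSet_subset {k : ℕ} (M : Fin k → G.Subgraph) :
    (⋃ i, (M i).edgeSet) ⊆ G.edgeSet :=
  Set.iUnion_subset fun i => (M i).edgeSet_subset

lemma bddAbove_cover (G : SimpleGraph V) (k : ℕ) :
    BddAbove {n : ℕ | ∃ M : Fin k → G.Subgraph,
      AreOneFactors G M ∧ n = (⋃ i, (M i).edgeSet).ncard} := by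
  refine ⟨G.edgeSet.ncard, ?_⟩
  rintro n ⟨M, -, rfl⟩
  exact Set.ncard_le_ncard (iUnion_edgeSet_subset M) (Set.toFinite _)

lemma ncard_uncovered_add (M : Fin 3 → G.Subgraph) :
    (uncovered G M).ncard + (⋃ i, (M i).edgeSet).ncard = G.edgeSet.ncard :=
  Set.ncard_sdiff_add_ncard_of_subset (iUnion_edgeSet_subset M) (Set.toFinite _)

lemma mu_le_ncard_uncovered {M : Fin 3 → G.Subgraph} (hM : AreOneFactors G M) :
    mu G 3 ≤ (uncovered G M).ncard := by
  have h1 := ncard_uncovered_add M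
  have h2 : (⋃ i, (M i).edgeSet).ncard ≤ maxCover G 3 :=
    le_csSup (bddAbove_cover G 3) ⟨M, hM, rfl⟩
  unfold mu
  omega

lemma exists_ncard_uncovered_eq_mu {N : G.Subgraph} (hN : N.IsPerfectMatching) :
    ∃ M : Fin 3 → G.Subgraph, AreOneFactors G M ∧ (uncovered G M).ncard = mu G 3 := by
  -- The constant triple `N` makes the set nonempty, so the supremum is attained.
  obtain ⟨M, hM, h⟩ := Nat.sSup_mem
    (s := {n : ℕ | ∃ M : Fin 3 → G.Subgraph,
      AreOneFactors G M ∧ n = (⋃ i, (M i).edgeSet).ncard})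
    ⟨_, fun _ => N, fun _ => hN, rfl⟩ (bddAbove_cover G 3)
  refine ⟨M, hM, ?_⟩
  have h1 := ncard_uncovered_add M
  have h2 : maxCover G 3 = (⋃ i, (M i).edgeSet).ncard := h
  unfold mu
  omega

/-- In an optimal triple no 1-factor can be replaced by one that covers more. -/
lemma not_optimal_of_exchange {M : Fin 3 → G.Subgraph} (hM : AreOneFactors G M)
    (hopt : (uncovered G M).ncard = mu G 3) {N : G.Subgraph} (hN : N.IsPerfectMatching)
    (i : Fin 3) (hkeep : ∀ v w, (M i).Adj v w → N.Adj v w ∨ ∃ j, j ≠ i ∧ (M j).Adj v w)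
    {a b : V} (hab : s(a, b) ∈ uncovered G M) (hNab : N.Adj a b) : False := by
  have hM' : AreOneFactors G (Function.update M i N) := by
    intro j
    by_cases h : j = i
    · subst h; simpa using hN
    · simpa [h] using hM j
  have hle := mu_le_ncard_uncovered hM'
  have hlt : (uncovered G (Function.update M i N)).ncard < (uncovered G M).ncard := by
    refine Set.ncard_lt_ncard (Set.ssubset_iff_of_subset ?_ |>.2 ⟨s(a, b), hab, ?_⟩)
      (Set.toFinite _)
    · intro e
      induction e with | h v w =>
      rw [mk_mem_uncovered, mk_mem_uncovered]
      rintro ⟨h1, h2⟩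
      refine ⟨h1, fun j hj => ?_⟩
      by_cases h : j = i
      · subst h
        obtain h' | ⟨l, hl, h'⟩ := hkeep v w hj
        · exact h2 j (by simpa using h')
        · exact h2 l (by simpa [hl] using h')
      · exact h2 j (by simpa [h] using hj)
    · rw [mk_mem_uncovered]
      exact fun h => h.2 i (by simpa using hNab)
  omega

end Cover

/-! ### Inclusion-exclusion for three sets -/

section Finset

open Finset

variable {α : Type*} [DecidableEq α]

lemma card_sdiff_union_three {E A B C : Finset α} (hA : A ⊆ E) (hB : B ⊆ E) (hC : C ⊆ E)
    (hE : E.card = A.card + B.card + C.card) :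
    (E \ (A ∪ B ∪ C)).card + (A ∩ B ∩ C).card =
      (A ∩ B).card + (A ∩ C).card + (B ∩ C).card := by
  have h1 := card_sdiff_add_card_eq_card (union_subset (union_subset hA hB) hC)
  have h2 := card_union_add_card_inter (A ∪ B) C
  have h3 := card_union_add_card_inter A B
  have h4 := card_union_add_card_inter (A ∩ C) (B ∩ C)
  rw [← union_inter_distrib_right, ← inter_inter_distrib_right] at h4
  omega

lemma card_pairwise_inter_three (A B C : Finset α) :
    (A ∩ B ∪ A ∩ C ∪ B ∩ C).card + 2 * (A ∩ B ∩ C).card =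
      (A ∩ B).card + (A ∩ C).card + (B ∩ C).card := by
  have h1 := card_union_add_card_inter (A ∩ B ∪ A ∩ C) (B ∩ C)
  have h2 := card_union_add_card_inter (A ∩ B) (A ∩ C)
  have h3 : (A ∩ B ∪ A ∩ C) ∩ (B ∩ C) = A ∩ B ∩ C := by
    ext x; simp only [mem_inter, mem_union]; tauto
  have h4 : A ∩ B ∩ (A ∩ C) = A ∩ B ∩ C := by
    ext x; simp only [mem_inter]; tauto
  rw [h3] at h1
  rw [h4] at h2
  omega

end Finset

/-! ### Structure of cores and triples with empty intersection -/

section Triple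

variable {V : Type*} [Fintype V] {G : SimpleGraph V} [DecidableRel G.Adj]

lemma ncard_inter_sum (hcubic : G.IsRegularOfDegree 3) {M : Fin 3 → G.Subgraph}
    (hM : AreOneFactors G M) :
    (uncovered G M).ncard + (⋂ i, (M i).edgeSet).ncard =
        ((M 0).edgeSet ∩ (M 1).edgeSet).ncard + ((M 0).edgeSet ∩ (M 2).edgeSet).ncard +
          ((M 1).edgeSet ∩ (M 2).edgeSet).ncard ∧
      (multiplyCovered G M).ncard + 2 * (⋂ i, (M i).edgeSet).ncard =
        ((M 0).edgeSet ∩ (M 1).edgeSet).ncard + ((M 0).edgeSet ∩ (M 2).edgeSet).ncard +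
          ((M 1).edgeSet ∩ (M 2).edgeSet).ncard := by
  classical
  have hE := two_mul_ncard_edgeSet hcubic
  have h0 := two_mul_ncard_edgeSet_of_isPerfectMatching (hM 0)
  have h1 := two_mul_ncard_edgeSet_of_isPerfectMatching (hM 1)
  have h2 := two_mul_ncard_edgeSet_of_isPerfectMatching (hM 2)
  have hU : uncovered G M = ↑(G.edgeSet.toFinset \
      ((M 0).edgeSet.toFinset ∪ (M 1).edgeSet.toFinset ∪ (M 2).edgeSet.toFinset)) := by
    ext e
    simp [uncovered, Fin.forall_fin_succ]
  have hI : (⋂ i, (M i).edgeSet) = ↑((M 0).edgeSet.toFinset ∩ (M 1).edgeSet.toFinset ∩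
      (M 2).edgeSet.toFinset) := by
    ext e
    simp [Fin.forall_fin_succ]
  have hm : multiplyCovered G M = ↑((M 0).edgeSet.toFinset ∩ (M 1).edgeSet.toFinset ∪
      (M 0).edgeSet.toFinset ∩ (M 2).edgeSet.toFinset ∪
      (M 1).edgeSet.toFinset ∩ (M 2).edgeSet.toFinset) := by
    ext e
    simp [multiplyCovered, Fin.exists_fin_succ]
    tauto
  have hp : ∀ i j, (M i).edgeSet ∩ (M j).edgeSet =
      ↑((M i).edgeSet.toFinset ∩ (M j).edgeSet.toFinset) := by
    intro i j
    simp
  simp only [Set.ncard_eq_toFinset_card' (M _).edgeSet] at h0 h1 h2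
  rw [Set.ncard_eq_toFinset_card' G.edgeSet] at hE
  simp only [hU, hI, hm, hp, Set.ncard_coe_finset]
  refine ⟨card_sdiff_union_three ?_ ?_ ?_ (by omega), card_pairwise_inter_three _ _ _⟩ <;>
  · rw [Set.toFinset_subset_toFinset]
    exact SimpleGraph.Subgraph.edgeSet_subset _

lemma ncard_uncovered_eq (hcubic : G.IsRegularOfDegree 3) {M : Fin 3 → G.Subgraph}
    (hM : AreOneFactors G M) :
    (uncovered G M).ncard = (multiplyCovered G M).ncard + (⋂ i, (M i).edgeSet).ncard := by
  have := ncard_inter_sum hcubic hM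
  omega

/-- Pigeonhole: the three 1-factors have only two edges at `v` left to use. -/
lemma exists_mk_mem_multiplyCovered (hcubic : G.IsRegularOfDegree 3) {M : Fin 3 → G.Subgraph}
    (hM : AreOneFactors G M) {v w : V} (h : s(v, w) ∈ uncovered G M) :
    ∃ u, s(v, u) ∈ multiplyCovered G M := by
  classical
  obtain ⟨f, hadj, -, hf⟩ := hM.exists_partners
  rw [mk_mem_uncovered] at h
  have hcard : ((G.neighborFinset v).erase w).card < (Finset.univ : Finset (Fin 3)).card := by
    rw [Finset.card_erase_of_mem (by simpa using h.1), G.card_neighborFinset_eq_degree, hcubic v]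
    simp
  obtain ⟨i, -, j, -, hij, hfij⟩ := Finset.exists_ne_map_eq_of_card_lt_of_maps_to hcard
    (f := fun i => f i v) (fun i _ => by
      have : f i v ≠ w := fun h' => h.2 i ((hf _ _ _).2 h')
      simpa [this] using hadj i v)
  exact ⟨f i v, i, j, hij, (hf _ _ _).2 rfl, (hf _ _ _).2 hfij.symm⟩

omit [Fintype V] [DecidableRel G.Adj] in
/-- An edge meeting an edge common to all three 1-factors is uncovered. -/
lemma mk_mem_uncovered_of_common {M : Fin 3 → G.Subgraph} (hM : AreOneFactors G M) {x y w : V}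
    (hxy : ∀ i, (M i).Adj x y) (hxw : G.Adj x w) (hw : w ≠ y) : s(x, w) ∈ uncovered G M :=
  mk_mem_uncovered.2 ⟨hxw, fun i h => hw ((hM i).1.eq_of_adj_left h (hxy i))⟩

lemma exists_other_neighbors (hcubic : G.IsRegularOfDegree 3) {x y : V} (hxy : G.Adj x y) :
    ∃ a b, a ≠ b ∧ a ≠ y ∧ b ≠ y ∧ G.Adj x a ∧ G.Adj x b ∧
      ∀ w, G.Adj x w → w = y ∨ w = a ∨ w = b := by
  classical
  have hcard : ((G.neighborFinset x).erase y).card = 2 := by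
    rw [Finset.card_erase_of_mem (by simpa using hxy), G.card_neighborFinset_eq_degree, hcubic x]
  obtain ⟨a, b, hab, h⟩ := Finset.card_eq_two.1 hcard
  have hmem : ∀ w, (w ≠ y ∧ G.Adj x w) ↔ (w = a ∨ w = b) := fun w => by
    have := Finset.ext_iff.1 h w
    simpa using this
  have ha := (hmem a).2 (.inl rfl)
  have hb := (hmem b).2 (.inr rfl)
  refine ⟨a, b, hab, ha.1, hb.1, ha.2, hb.2, fun w hw => ?_⟩
  by_cases hwy : w = y
  · exact .inl hwy
  · exact .inr ((hmem w).1 ⟨hwy, hw⟩)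

/-- A core is cyclic as soon as no edge lies in all three 1-factors. -/
lemma isCycle_edgeInduced (hcubic : G.IsRegularOfDegree 3) {M : Fin 3 → G.Subgraph}
    (hM : AreOneFactors G M) (hempty : (⋂ i, (M i).edgeSet) = ∅) :
    IsCycle (edgeInduced G (multiplyCovered G M ∪ uncovered G M)) := by
  rintro v ⟨w, hvw, hw⟩
  obtain ⟨f, hadj, -, hf⟩ := hM.exists_partners
  have hmul : ∃ u, s(v, u) ∈ multiplyCovered G M := by
    obtain hw | hw := hw
    · exact ⟨w, hw⟩
    · exact exists_mk_mem_multiplyCovered hcubic hM hw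
  obtain ⟨u, i, j, hij, hi, hj⟩ := hmul
  change (M i).Adj v u at hi
  change (M j).Adj v u at hj
  obtain ⟨l, hl⟩ : ∃ l, f l v ≠ u := by
    by_contra! h
    have : s(v, u) ∈ ⋂ i, (M i).edgeSet := Set.mem_iInter.2 fun i => (hf i v u).2 (h i)
    rw [hempty] at this
    exact this
  rw [hf] at hi hj
  have hl3 : ∀ r, r = i ∨ r = j ∨ r = l := by
    have hli : l ≠ i := by rintro rfl; exact hl hi
    have hlj : l ≠ j := by rintro rfl; exact hl hj
    intro r
    omega
  obtain ⟨a, b, hab, hau, hbu, ha, hb, hall⟩ := exists_other_neighbors hcubic (hi ▸ hadj i v)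
  -- Two 1-factors share the edge `vu`, so the edge of the third one, `l`, is the only edge at `v`
  -- covered exactly once.
  have hset : (edgeInduced G (multiplyCovered G M ∪ uncovered G M)).neighborSet v =
      {w | G.Adj v w ∧ w ≠ f l v} := by
    ext w
    change G.Adj v w ∧ (s(v, w) ∈ multiplyCovered G M ∨ s(v, w) ∈ uncovered G M) ↔ _
    rw [mk_mem_multiplyCovered, mk_mem_uncovered]
    simp only [hf, Set.mem_ofPred_eq]
    constructor
    · rintro ⟨h, ⟨p, q, hpq, hp, hq⟩ | ⟨-, h'⟩⟩
      · refine ⟨h, ?_⟩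
        rintro rfl
        rcases hl3 p with rfl | rfl | rfl <;> rcases hl3 q with rfl | rfl | rfl <;> simp_all
      · exact ⟨h, fun h'' => h' l h''.symm⟩
    · rintro ⟨h, h'⟩
      refine ⟨h, ?_⟩
      by_cases hwu : w = u
      · exact .inl ⟨i, j, hij, hi.trans hwu.symm, hj.trans hwu.symm⟩
      · refine .inr ⟨h, fun r hr => ?_⟩
        rcases hl3 r with rfl | rfl | rfl
        · exact hwu (hr.symm.trans hi)
        · exact hwu (hr.symm.trans hj)
        · exact h' hr.symm
  rw [hset, Set.ncard_eq_two]
  have hvu : G.Adj v u := hi ▸ hadj i v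
  rcases hall _ (hadj l v) with h | h | h
  · exact absurd h hl
  · refine ⟨u, b, hbu.symm, ?_⟩
    ext w
    simp only [Set.mem_ofPred_eq, Set.mem_insert_iff, Set.mem_singleton_iff, h]
    constructor
    · rintro ⟨h1, h2⟩; have := hall w h1; tauto
    · rintro (rfl | rfl)
      · exact ⟨hvu, hau.symm⟩
      · exact ⟨hb, hab.symm⟩
  · refine ⟨u, a, hau.symm, ?_⟩
    ext w
    simp only [Set.mem_ofPred_eq, Set.mem_insert_iff, Set.mem_singleton_iff, h]
    constructor
    · rintro ⟨h1, h2⟩; have := hall w h1; tauto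
    · rintro (rfl | rfl)
      · exact ⟨hvu, hbu.symm⟩
      · exact ⟨ha, hab⟩

omit [Fintype V] [DecidableRel G.Adj] in
lemma ne_of_edgeSet_inter_eq_empty [Nonempty V] {A B : G.Subgraph} (hA : A.IsPerfectMatching)
    (h : A.edgeSet ∩ B.edgeSet = ∅) : A ≠ B := by
  rintro rfl
  obtain ⟨v⟩ := ‹Nonempty V›
  obtain ⟨w, hw, -⟩ := SimpleGraph.Subgraph.isPerfectMatching_iff.1 hA v
  have : s(v, w) ∈ A.edgeSet ∩ A.edgeSet := ⟨hw, hw⟩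
  rw [h] at this
  exact this

/-- Removing two disjoint 1-factors from a cubic graph leaves a 1-regular graph. -/
lemma exists_disjoint_of_disjoint (hcubic : G.IsRegularOfDegree 3) {A B : G.Subgraph}
    (hA : A.IsPerfectMatching) (hB : B.IsPerfectMatching) (h : A.edgeSet ∩ B.edgeSet = ∅) :
    ∃ C : G.Subgraph, C.IsPerfectMatching ∧ C.edgeSet ∩ A.edgeSet = ∅ ∧
      C.edgeSet ∩ B.edgeSet = ∅ := by
  refine ⟨{ verts := Set.univ
            Adj := fun v w => G.Adj v w ∧ ¬ A.Adj v w ∧ ¬ B.Adj v w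
            adj_sub := fun h => h.1
            edge_vert := fun _ => Set.mem_univ _
            symm := ⟨fun v w h => ⟨h.1.symm, fun h' => h.2.1 h'.symm,
              fun h' => h.2.2 h'.symm⟩⟩ }, ?_, ?_, ?_⟩
  · rw [SimpleGraph.Subgraph.isPerfectMatching_iff]
    intro v
    obtain ⟨f, hf, -, hfA⟩ := exists_partner hA
    obtain ⟨g, hg, -, hgB⟩ := exists_partner hB
    have hne : g v ≠ f v := by
      intro h'
      have : s(v, f v) ∈ A.edgeSet ∩ B.edgeSet := ⟨(hfA _ _).2 rfl, (hgB _ _).2 h'⟩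
      rw [h] at this
      exact this
    obtain ⟨a, b, hab, hay, hby, ha, hb, hall⟩ := exists_other_neighbors hcubic (hf v)
    simp only [hfA, hgB]
    rcases hall _ (hg v) with h' | h' | h'
    · exact absurd h' hne
    · refine ⟨b, ⟨hb, hby.symm, h' ▸ hab⟩, ?_⟩
      rintro w ⟨h1, h2, h3⟩
      rcases hall w h1 with rfl | rfl | rfl <;> simp_all
    · refine ⟨a, ⟨ha, hay.symm, h' ▸ hab.symm⟩, ?_⟩
      rintro w ⟨h1, h2, h3⟩
      rcases hall w h1 with rfl | rfl | rfl <;> simp_all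
  · rw [Set.eq_empty_iff_forall_notMem]
    intro e
    induction e with | h v w => exact fun h => h.1.2.1 h.2
  · rw [Set.eq_empty_iff_forall_notMem]
    intro e
    induction e with | h v w => exact fun h => h.1.2.2 h.2

/-- A triple of 1-factors with empty intersection can be chosen without repetition. -/
lemma exists_injective_of_inter_eq_empty [Nonempty V] (hcubic : G.IsRegularOfDegree 3)
    {A B C : G.Subgraph} (hA : A.IsPerfectMatching) (hB : B.IsPerfectMatching)
    (hC : C.IsPerfectMatching) (h : A.edgeSet ∩ B.edgeSet ∩ C.edgeSet = ∅) :
    ∃ M : Fin 3 → G.Subgraph, AreOneFactors G M ∧ Function.Injective M ∧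
      (⋂ i, (M i).edgeSet) = ∅ := by
  have key : ∀ A B C : G.Subgraph, A.IsPerfectMatching → B.IsPerfectMatching →
      C.IsPerfectMatching → A.edgeSet ∩ B.edgeSet ∩ C.edgeSet = ∅ → A ≠ B → A ≠ C → B ≠ C →
      ∃ M : Fin 3 → G.Subgraph, AreOneFactors G M ∧ Function.Injective M ∧
        (⋂ i, (M i).edgeSet) = ∅ := by
    intro A B C hA hB hC h hAB hAC hBC
    refine ⟨![A, B, C], ?_, ?_, ?_⟩
    · intro i
      fin_cases i <;> assumption
    · intro i j hij
      fin_cases i <;> fin_cases j <;> simp_all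
    · rw [← h]
      ext e
      simp [Fin.forall_fin_succ, and_assoc]
  -- A triple with a repetition and empty intersection amounts to two disjoint 1-factors.
  have hdisj : ∀ A B : G.Subgraph, A.IsPerfectMatching → B.IsPerfectMatching →
      A.edgeSet ∩ B.edgeSet = ∅ → ∃ M : Fin 3 → G.Subgraph, AreOneFactors G M ∧
        Function.Injective M ∧ (⋂ i, (M i).edgeSet) = ∅ := by
    intro A B hA hB h
    obtain ⟨C, hC, hCA, hCB⟩ := exists_disjoint_of_disjoint hcubic hA hB h
    exact key A B C hA hB hC (by rw [h, Set.empty_inter]) (ne_of_edgeSet_inter_eq_empty hA h)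
      (ne_of_edgeSet_inter_eq_empty hC hCA).symm (ne_of_edgeSet_inter_eq_empty hC hCB).symm
  by_cases hAB : A = B
  · subst hAB
    exact hdisj A C hA hC (by simpa using h)
  by_cases hAC : A = C
  · subst hAC
    refine hdisj A B hA hB (by rwa [Set.inter_right_comm, Set.inter_self] at h)
  by_cases hBC : B = C
  · subst hBC
    exact hdisj A B hA hB (by rwa [Set.inter_assoc, Set.inter_self] at h)
  exact key A B C hA hB hC h hAB hAC hBC

end Triple

end CubicCover

namespace CubicCover

/-! ### Improving triples that have a common edge -/

section Improve

variable {V : Type*} [Fintype V] {G : SimpleGraph V}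

/-- In an optimal triple, an edge `xy` common to all three 1-factors and a multiply covered edge
`ab` do not form a square with two uncovered edges `xa` and `yb`. -/
lemma not_optimal_of_square {M : Fin 3 → G.Subgraph} (hM : AreOneFactors G M)
    (hopt : (uncovered G M).ncard = mu G 3) {x y a b : V} (hxy : ∀ i, (M i).Adj x y)
    (hxa : s(x, a) ∈ uncovered G M) (hyb : s(y, b) ∈ uncovered G M)
    (hab : s(a, b) ∈ multiplyCovered G M) : False := by
  classical
  obtain ⟨f, hadj, hinv, hf⟩ := hM.exists_partners
  obtain ⟨i, j, hij, hi, hj⟩ := mk_mem_multiplyCovered.1 hab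
  have hxa' := mk_mem_uncovered.1 hxa
  have hyb' := mk_mem_uncovered.1 hyb
  have hfx : f i x = y := (hf _ _ _).1 (hxy i)
  have hfy : f i y = x := hfx ▸ hinv i x
  have hfa : f i a = b := (hf _ _ _).1 hi
  have hfb : f i b = a := hfa ▸ hinv i a
  have hne1 : x ≠ y := (hxy i).ne
  have hne2 : a ≠ b := hi.ne
  have hne3 : x ≠ a := hxa'.1.ne
  have hne4 : y ≠ b := hyb'.1.ne
  have hne5 : a ≠ y := by rintro rfl; exact hxa'.2 i (hxy i)
  have hne6 : b ≠ x := by rintro rfl; exact hyb'.2 i (hxy i).symm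
  -- Conjugating `f i` by this transposition replaces `xy` and `ab` by `xa` and `yb`. The lost edges
  -- stay covered by `M j`.
  let σ := Equiv.swap y a
  have hσ : ∀ v, v ≠ y → v ≠ a → σ v = v := fun v h h' => Equiv.swap_apply_of_ne_of_ne h h'
  have hσy : σ y = a := Equiv.swap_apply_left y a
  have hσa : σ a = y := Equiv.swap_apply_right y a
  have hσσ : ∀ v, σ (σ v) = v := Equiv.swap_apply_self y a
  have hgen : ∀ v, v ≠ y → v ≠ a → v ≠ x → v ≠ b → σ (f i (σ v)) = f i v := by
    intro v h1 h2 h3 h4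
    rw [hσ v h1 h2]
    refine hσ _ (fun h => h3 ?_) (fun h => h4 ?_)
    · rw [← hinv i v, h, hfy]
    · rw [← hinv i v, h, hfa]
  have hN : ∀ v, G.Adj v (σ (f i (σ v))) := by
    intro v
    by_cases h1 : v = y
    · subst h1
      rw [hσy, hfa, hσ b hne4.symm hne2.symm]
      exact hyb'.1
    by_cases h2 : v = a
    · subst h2
      rw [hσa, hfy, hσ x hne1 hne3]
      exact hxa'.1.symm
    by_cases h3 : v = x
    · subst h3
      rw [hσ v hne1 hne3, hfx, hσy]
      exact hxa'.1
    by_cases h4 : v = b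
    · subst h4
      rw [hσ v h1 h2, hfb, hσa]
      exact hyb'.1.symm
    rw [hgen v h1 h2 h3 h4]
    exact hadj i v
  have hNinv : ∀ v, σ (f i (σ (σ (f i (σ v))))) = v := by
    intro v
    rw [hσσ, hinv, hσσ]
  refine not_optimal_of_exchange hM hopt (ofPartner_isPerfectMatching hN hNinv) i ?_ hxa ?_
  · intro v w hvw
    by_cases h1 : v = y
    · subst h1
      obtain rfl : x = w := (hM i).1.eq_of_adj_left (hxy i).symm hvw
      exact .inr ⟨j, hij.symm, (hxy j).symm⟩
    by_cases h2 : v = a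
    · subst h2
      obtain rfl : b = w := (hM i).1.eq_of_adj_left hi hvw
      exact .inr ⟨j, hij.symm, hj⟩
    by_cases h3 : v = x
    · subst h3
      obtain rfl : y = w := (hM i).1.eq_of_adj_left (hxy i) hvw
      exact .inr ⟨j, hij.symm, hxy j⟩
    by_cases h4 : v = b
    · subst h4
      obtain rfl : a = w := (hM i).1.eq_of_adj_left hi.symm hvw
      exact .inr ⟨j, hij.symm, hj.symm⟩
    exact .inl ((hgen v h1 h2 h3 h4).trans ((hf _ _ _).1 hvw))
  · change σ (f i (σ x)) = a
    rw [hσ x hne1 hne3, hfx, hσy]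

variable [DecidableRel G.Adj]

/-- In an optimal triple with an edge common to all three 1-factors, some edge is covered exactly
twice. -/
lemma not_optimal_of_multiplyCovered_subset (hcubic : G.IsRegularOfDegree 3)
    (hbridge : Bridgeless G) {M : Fin 3 → G.Subgraph} (hM : AreOneFactors G M)
    (hopt : (uncovered G M).ncard = mu G 3) (hsub : multiplyCovered G M ⊆ ⋂ i, (M i).edgeSet)
    {x y : V} (hxy : ∀ i, (M i).Adj x y) : False := by
  classical
  obtain ⟨f, hadj, hinv, hf⟩ := hM.exists_partners
  obtain ⟨N, hN, hNxy⟩ := exists_isPerfectMatching_avoiding hcubic hbridge {s(x, y)} (by simp)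
  obtain ⟨g, hg, hginv, hgN⟩ := exists_partner hN
  have hgx : g x ≠ y := fun h => hNxy s(x, y) (by simp) ((hgN _ _).2 h)
  -- The vertices where all three 1-factors agree form a union of components: the far end of an
  -- uncovered edge meets a multiply covered edge, which by `hsub` is common to all three.
  let W : V → Prop := fun v => ∀ i, f i v = f 0 v
  have hclosed : ∀ v w, W v → G.Adj v w → W w := by
    intro v w hv hvw
    by_cases hw : w = f 0 v
    · intro i
      rw [hw, hinv, ← hv i, hinv]
    · have hunc : s(w, v) ∈ uncovered G M := mk_mem_uncovered.2 ⟨hvw.symm, fun i h =>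
        hw (((hf _ _ _).1 h.symm).symm.trans (hv i))⟩
      obtain ⟨u, hu⟩ := exists_mk_mem_multiplyCovered hcubic hM hunc
      have hu' : ∀ i, f i w = u := fun i => (hf _ _ _).1 (Set.mem_iInter.1 (hsub hu) i)
      intro i
      rw [hu' i, hu' 0]
  have hWx : W x := fun i => ((hf _ _ _).1 (hxy i)).trans ((hf _ _ _).1 (hxy 0)).symm
  -- Inside `W` the edges given up by `M 0` remain in `M 1`, while `N` brings in an uncovered edge
  -- at `x`.
  let F : V → V := fun v => if W v then g v else f 0 v
  have hF : ∀ v, G.Adj v (F v) := by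
    intro v
    by_cases h : W v
    · simpa [F, h] using hg v
    · simpa [F, h] using hadj 0 v
  have hFinv : ∀ v, F (F v) = v := by
    intro v
    by_cases h : W v
    · have h' : W (g v) := hclosed _ _ h (hg v)
      simp [F, h, h', hginv]
    · have h' : ¬ W (f 0 v) := fun h' => h (hclosed _ _ h' (hadj 0 v).symm)
      simp [F, h, h', hinv]
  refine not_optimal_of_exchange hM hopt (ofPartner_isPerfectMatching hF hFinv) 0 ?_
    (mk_mem_uncovered_of_common hM hxy (hg x) hgx) ?_
  · intro v w hvw
    rw [hf] at hvw
    by_cases h : W v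
    · exact .inr ⟨1, by decide, (hf _ _ _).2 ((h 1).trans hvw)⟩
    · exact .inl ((if_neg h).trans hvw)
  · exact if_pos hWx

/-- A triangle-free graph has an optimal triple with a common edge only if `6 ≤ μ₃`. -/
lemma six_le_ncard_uncovered (hcubic : G.IsRegularOfDegree 3) (hfree : G.CliqueFree 3)
    {M : Fin 3 → G.Subgraph} (hM : AreOneFactors G M)
    (hopt : (uncovered G M).ncard = mu G 3) {x y : V} (hxy : ∀ i, (M i).Adj x y) :
    6 ≤ (uncovered G M).ncard := by
  classical
  have htri : ∀ u v w, G.Adj u v → G.Adj u w → ¬ G.Adj v w := by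
    intro u v w h1 h2 h3
    exact hfree {u, v, w} (SimpleGraph.is3Clique_triple_iff.2 ⟨h1, h2, h3⟩)
  have hGxy : G.Adj x y := (hxy 0).adj_sub
  obtain ⟨a, a', haa', hay, hay', hxa, hxa', -⟩ := exists_other_neighbors hcubic hGxy
  obtain ⟨b, b', hbb', hbx, hbx', hyb, hyb', -⟩ := exists_other_neighbors hcubic hGxy.symm
  have hyx : ∀ i, (M i).Adj y x := fun i => (hxy i).symm
  have hua := mk_mem_uncovered_of_common hM hxy hxa hay
  have hua' := mk_mem_uncovered_of_common hM hxy hxa' hay'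
  have hub := mk_mem_uncovered_of_common hM hyx hyb hbx
  have hub' := mk_mem_uncovered_of_common hM hyx hyb' hbx'
  have hmul : ∀ z w, s(z, w) ∈ uncovered G M → ∃ u, s(w, u) ∈ multiplyCovered G M :=
    fun z w h => exists_mk_mem_multiplyCovered hcubic hM (Sym2.eq_swap ▸ h)
  have hmadj : ∀ v w, s(v, w) ∈ multiplyCovered G M → G.Adj v w := by
    rintro v w ⟨i, j, -, h, -⟩
    exact SimpleGraph.Subgraph.Adj.adj_sub h
  obtain ⟨c, hc⟩ := hmul x a hua
  obtain ⟨c', hc'⟩ := hmul x a' hua'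
  obtain ⟨d, hd⟩ := hmul y b hub
  obtain ⟨d', hd'⟩ := hmul y b' hub'
  have hxym : s(x, y) ∈ multiplyCovered G M := ⟨0, 1, by decide, hxy 0, hxy 1⟩
  have hsame : ∀ z p q r t, p ≠ q → G.Adj z p → G.Adj z q → s(p, r) ∈ multiplyCovered G M →
      s(p, r) ≠ s(q, t) := by
    intro z p q r t hpq hp hq hr h
    rcases Sym2.eq_iff.1 h with ⟨h1, -⟩ | ⟨-, rfl⟩
    · exact hpq h1
    · exact htri z p r hp hq (hmadj _ _ hr)
  -- Equality means either `p = q`, a triangle with `xy`, or that `pq` is multiply covered, which is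
  -- the excluded square.
  have hcross : ∀ p q r t, s(x, p) ∈ uncovered G M → s(y, q) ∈ uncovered G M →
      s(p, r) ∈ multiplyCovered G M → s(p, r) ≠ s(q, t) := by
    intro p q r t hp hq hr h
    rcases Sym2.eq_iff.1 h with ⟨rfl, -⟩ | ⟨-, rfl⟩
    · exact htri p x y (mk_mem_uncovered.1 hp).1.symm (mk_mem_uncovered.1 hq).1.symm hGxy
    · exact not_optimal_of_square hM hopt hxy hp hq hr
  have hoff : ∀ z p r, s(z, p) ∈ uncovered G M → z = x ∨ z = y →
      s(p, r) ≠ s(x, y) := by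
    rintro z p r hp hz h
    have hp' := mk_mem_uncovered.1 hp
    rcases Sym2.eq_iff.1 h with ⟨rfl, -⟩ | ⟨rfl, -⟩ <;> rcases hz with rfl | rfl
    · exact hp'.1.ne rfl
    · exact hp'.2 0 (hyx 0)
    · exact hp'.2 0 (hxy 0)
    · exact hp'.1.ne rfl
  have hfive : 5 ≤ (multiplyCovered G M).ncard := by
    have hcard : ({s(a, c), s(a', c'), s(b, d), s(b', d'), s(x, y)} : Finset (Sym2 V)).card = 5 := by
      rw [Finset.card_insert_of_notMem, Finset.card_insert_of_notMem,
        Finset.card_insert_of_notMem, Finset.card_insert_of_notMem, Finset.card_singleton]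
      · simpa only [Finset.mem_singleton] using hoff y b' d' hub' (.inr rfl)
      · simp only [Finset.mem_insert, Finset.mem_singleton, not_or]
        exact ⟨hsame y b b' d d' hbb' hyb hyb' hd, hoff y b d hub (.inr rfl)⟩
      · simp only [Finset.mem_insert, Finset.mem_singleton, not_or]
        exact ⟨hcross _ _ _ _ hua' hub hc', hcross _ _ _ _ hua' hub' hc',
          hoff x a' c' hua' (.inl rfl)⟩
      · simp only [Finset.mem_insert, Finset.mem_singleton, not_or]
        exact ⟨hsame x a a' c c' haa' hxa hxa' hc, hcross _ _ _ _ hua hub hc,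
          hcross _ _ _ _ hua hub' hc, hoff x a c hua (.inl rfl)⟩
    rw [← hcard, ← Set.ncard_coe_finset]
    refine Set.ncard_le_ncard ?_ (Set.toFinite _)
    intro e he
    simp only [Finset.coe_insert, Finset.coe_singleton, Set.mem_insert_iff,
      Set.mem_singleton_iff] at he
    rcases he with rfl | rfl | rfl | rfl | rfl <;> assumption
  have hone : 0 < (⋂ i, (M i).edgeSet).ncard :=
    (Set.ncard_pos (Set.toFinite _)).2 ⟨s(x, y), Set.mem_iInter.2 hxy⟩
  have := ncard_uncovered_eq hcubic hM
  omega

/-- If `μ₃(G) ≤ 6`, then `G` has three different 1-factors with empty intersection. -/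
lemma exists_inter_eq_empty [Nonempty V] (hcubic : G.IsRegularOfDegree 3)
    (hbridge : Bridgeless G) (hmu : mu G 3 ≤ 6) :
    ∃ M : Fin 3 → G.Subgraph, AreOneFactors G M ∧ Function.Injective M ∧
      (⋂ i, (M i).edgeSet) = ∅ := by
  classical
  obtain ⟨N, hN, -⟩ := exists_isPerfectMatching_avoiding hcubic hbridge ∅ (by simp)
  obtain ⟨M, hM, hopt⟩ := exists_ncard_uncovered_eq_mu hN
  have hpair : ∀ i j, ((M i).edgeSet ∩ (M j).edgeSet).ncard ≤ 2 →
      ∃ M : Fin 3 → G.Subgraph, AreOneFactors G M ∧ Function.Injective M ∧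
        (⋂ i, (M i).edgeSet) = ∅ := by
    intro i j hij
    rw [Set.ncard_eq_toFinset_card'] at hij
    obtain ⟨N, hN, hN'⟩ := exists_isPerfectMatching_avoiding hcubic hbridge _ hij
    refine exists_injective_of_inter_eq_empty hcubic (hM i) (hM j) hN ?_
    rw [Set.eq_empty_iff_forall_notMem]
    exact fun e he => hN' e (Set.mem_toFinset.2 he.1) he.2
  by_cases h01 : ((M 0).edgeSet ∩ (M 1).edgeSet).ncard ≤ 2
  · exact hpair 0 1 h01
  by_cases h02 : ((M 0).edgeSet ∩ (M 2).edgeSet).ncard ≤ 2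
  · exact hpair 0 2 h02
  by_cases h12 : ((M 1).edgeSet ∩ (M 2).edgeSet).ncard ≤ 2
  · exact hpair 1 2 h12
  have hsub : (⋂ i, (M i).edgeSet) ⊆ multiplyCovered G M := fun e he =>
    ⟨0, 1, by decide, Set.mem_iInter.1 he 0, Set.mem_iInter.1 he 1⟩
  have hle := Set.ncard_le_ncard hsub (Set.toFinite _)
  have hsum := ncard_inter_sum hcubic hM
  -- From $|D| + 2|T| \ge 9$ and $|D| + |T| \le 6$ follow $|T| \ge 3 \ge |D|$.
  have heq : (⋂ i, (M i).edgeSet) = multiplyCovered G M :=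
    Set.eq_of_subset_of_ncard_le hsub (by omega) (Set.toFinite _)
  obtain ⟨e, he⟩ := (Set.ncard_pos (s := ⋂ i, (M i).edgeSet) (Set.toFinite _)).1 (by omega)
  induction e with | h x y =>
  exact (not_optimal_of_multiplyCovered_subset hcubic hbridge hM hopt heq.ge
    (x := x) (y := y) fun i => Set.mem_iInter.1 he i).elim

end Improve

end CubicCover

theorem mainTheorem1 {V : Type*} [Fintype V] [Nonempty V] (G : SimpleGraph V)
    [DecidableRel G.Adj] (hcubic : G.IsRegularOfDegree 3) (hbridge : CubicCover.Bridgeless G) :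
    (CubicCover.mu G 3 ≤ 6 →
      ∃ (k : ℕ) (M : Fin 3 → G.Subgraph) (H : G.Subgraph),
        CubicCover.IsCoreOf G k M H ∧ CubicCover.IsCycle H ∧ (⋂ i, (M i).edgeSet) = ∅) ∧
    (G.CliqueFree 3 → CubicCover.mu G 3 ≤ 5 →
      ∀ H : G.Subgraph, CubicCover.IsCore G (CubicCover.mu G 3) H → CubicCover.IsCycle H) := by
  constructor
  · intro hmu
    obtain ⟨M, hM, hinj, hempty⟩ := CubicCover.exists_inter_eq_empty hcubic hbridge hmu
    exact ⟨_, M, _, ⟨hM, hinj, rfl, rfl⟩, CubicCover.isCycle_edgeInduced hcubic hM hempty, hempty⟩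
  · rintro hfree hmu H ⟨M, hM, -, hopt, rfl⟩
    refine CubicCover.isCycle_edgeInduced hcubic hM (Set.eq_empty_iff_forall_notMem.2 fun e he => ?_)
    induction e with | h x y =>
    have := CubicCover.six_le_ncard_uncovered hcubic hfree hM hopt (x := x) (y := y) <|
      fun i => Set.mem_iInter.1 he i
    omega
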